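/- Let $k$ be an algebraically closed field of characteristic zero. A subset of $k^n$ ($n\ge 0$) is called constructible if it lies in the algebra of sets generated by the Zariski closed subsets of $k^n$. A map $f:A\to B$ between constructible sets $A\subseteq k^n$, $B\subseteq k^m$ is called definable if its graph is a constructible subset of $k^{n+m}$. Let $R$ be a commutative ring with $1$. An $R$-valued Euler characteristic on the constructible sets is a map $\chi$ assigning to each constructible $A\subseteq k^n$, for each $n\ge 0$, an element $\chi(A)\in R$ such that 1. $\chi(A\sqcup B)=\chi(A)+\chi(B)$ for disjoint constructible $A,B\subseteq k^n$; 2. $\chi(A\times B)=\chi(A)\chi(B)$ for constructible $A\subseteq k^n$, $B\subseteq k^m$; 3. $\chi(A)=\chi(B)$ whenever there is a definable bijection $A\to B$; 4. $\chi(\mathrm{pt})=1$, where $\mathrm{pt}=k^0$ is the one-point set. It is called strong if $\chi(A)=N\chi(B)$ for every definable map $f:A\to B$ between constructible sets all of whose fibres $f^{-1}(b)$, $b\in B$, have exactly $N$ elements, for some positive integer $N$. **Theorem.** There is at most one strong Euler characteristic on the constructible sets over $k$, and it is $\mathbb{Z}$-valued. Precisely: (a) for every commutative ring $R$, any two $R$-valued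 strong Euler characteristics on the constructible sets over $k$ are equal; (b) there is a function $e$ from the constructible sets (in all $k^n$, $n\ge 0$) to $\mathbb{Z}$ such that, for every commutative ring $R$, every $R$-valued strong Euler characteristic $\chi$ and every constructible set $A$, $\chi(A)$ is the image of $e(A)$ under the canonical map $\mathbb{Z}\to R$; here $e$ depends on neither $R$ nor $\chi$; (c) if $R$ is a commutative ring of characteristic zero (that is, $\mathbb{Z}\to R$ is injective), then every $R$-valued strong Euler characteristic is the composite of a $\mathbb{Z}$-valued strong Euler characteristic with $\mathbb{Z}\to R$. -/

import Mathlib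

universe u v

/-- A structure on a set `Ω`: for every `n ≥ 0` an algebra of subsets of `Ωⁿ`, called the definable
subsets, such that definable sets are stable under `A ↦ A × Ω`, `A ↦ Ω × A` and projection to the
first `n` coordinates, and such that `{x | x₁ = xₙ}` is definable for `n ≥ 1`. -/
structure DefinableStructure (Ω : Type u) where
  /-- The algebra of definable subsets of `Ωⁿ`. -/
  definable (n : ℕ) : BooleanSubalgebra (Set (Fin n → Ω))
  prod_univ_mem {n : ℕ} {A : Set (Fin n → Ω)} (hA : A ∈ definable n) :
    {x : Fin (n + 1) → Ω | (fun i : Fin n => x i.castSucc) ∈ A} ∈ definable (n + 1)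
  univ_prod_mem {n : ℕ} {A : Set (Fin n → Ω)} (hA : A ∈ definable n) :
    {x : Fin (n + 1) → Ω | (fun i : Fin n => x i.succ) ∈ A} ∈ definable (n + 1)
  diagonal_mem (n : ℕ) : {x : Fin (n + 1) → Ω | x 0 = x (Fin.last n)} ∈ definable (n + 1)
  proj_mem {n : ℕ} {A : Set (Fin (n + 1) → Ω)} (hA : A ∈ definable (n + 1)) :
    (fun (x : Fin (n + 1) → Ω) (i : Fin n) => x i.castSucc) '' A ∈ definable n

namespace DefinableStructure

variable {Ω : Type u} (𝒜 : DefinableStructure Ω)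

/-- The cartesian product of `A ⊆ Ωⁿ` and `B ⊆ Ωᵐ` as a subset of `Ωⁿ⁺ᵐ`. -/
def cartesian {n m : ℕ} (A : Set (Fin n → Ω)) (B : Set (Fin m → Ω)) : Set (Fin (n + m) → Ω) :=
  {x | (fun i : Fin n => x (Fin.castAdd m i)) ∈ A ∧ (fun j : Fin m => x (Fin.natAdd n j)) ∈ B}

theorem cartesian_mem {n m : ℕ} {A : Set (Fin n → Ω)} {B : Set (Fin m → Ω)}
    (hA : A ∈ 𝒜.definable n) (hB : B ∈ 𝒜.definable m) :
    cartesian A B ∈ 𝒜.definable (n + m) := by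
  have h1 : ∀ m : ℕ, {x : Fin (n + m) → Ω | (fun i : Fin n => x (Fin.castAdd m i)) ∈ A} ∈
      𝒜.definable (n + m) := by
    intro m
    induction m with
    | zero => exact hA
    | succ m ih => exact 𝒜.prod_univ_mem ih
  have h2 : ∀ (n N : ℕ) (h : n + m = N),
      {x : Fin N → Ω | (fun j : Fin m => x (Fin.cast h (Fin.natAdd n j))) ∈ B} ∈
      𝒜.definable N := by
    intro n
    induction n with
    | zero =>
      intro N h
      obtain rfl : m = N := by omega
      convert hB using 1
      ext x
      have : (fun j : Fin m => x (Fin.cast h (Fin.natAdd 0 j))) = x := by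
        funext j; congr 1; ext; simp
      rw [Set.mem_ofPred_eq, this]
    | succ n ih =>
      intro N h
      obtain ⟨N, rfl⟩ : ∃ N', N = N' + 1 := ⟨n + m, by omega⟩
      have := 𝒜.univ_prod_mem (ih N (by omega))
      convert this using 1
      ext x
      have : (fun j : Fin m => x (Fin.cast h (Fin.natAdd (n + 1) j))) =
          (fun j : Fin m => x (Fin.succ (Fin.cast (by omega) (Fin.natAdd n j)))) := by
        funext j; congr 1; ext; simp; omega
      simp only [Set.mem_ofPred_eq, this]
  exact BooleanSubalgebra.inf_mem (h1 m) (h2 n _ rfl)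

/-- The product of two definable sets, as a definable set. -/
def prod {n m : ℕ} (A : 𝒜.definable n) (B : 𝒜.definable m) : 𝒜.definable (n + m) :=
  ⟨cartesian A.1 B.1, 𝒜.cartesian_mem A.2 B.2⟩

/-- A map `f : A → B` between `A ⊆ Ωⁿ` and `B ⊆ Ωᵐ` is definable if its graph is a definable
subset of `Ωⁿ⁺ᵐ`. -/
def IsDefinableMap {n m : ℕ} {A : Set (Fin n → Ω)} {B : Set (Fin m → Ω)} (f : A → B) : Prop :=
  {z : Fin (n + m) → Ω | ∃ a : A, z = Fin.append a.1 (f a).1} ∈ 𝒜.definable (n + m)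

end DefinableStructure

/-- An Euler characteristic on a set `Ω` with a structure `𝒜`, with values in a commutative ring
`R`. It is normalised to take the value `1` on the one-point set `Ω⁰`. -/
@[ext]
structure EulerCharacteristic {Ω : Type u} (𝒜 : DefinableStructure Ω) (R : Type v)
    [CommRing R] where
  /-- The value of the Euler characteristic on a definable subset of `Ωⁿ`. -/
  val (n : ℕ) (A : 𝒜.definable n) : R
  val_union {n : ℕ} (A B : 𝒜.definable n) (h : Disjoint A.1 B.1) :
    val n (A ⊔ B) = val n A + val n B
  val_prod {n m : ℕ} (A : 𝒜.definable n) (B : 𝒜.definable m) :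
    val (n + m) (𝒜.prod A B) = val n A * val m B
  val_eq_of_bijective {n m : ℕ} (A : 𝒜.definable n) (B : 𝒜.definable m)
    (f : ↥A.1 → ↥B.1)
    (hf : 𝒜.IsDefinableMap f) (hbij : Function.Bijective f) : val n A = val m B
  val_point : val 0 ⊤ = 1

/-- An Euler characteristic `χ` is strong if `χ(A) = N χ(B)` whenever there is a definable map
`f : A → B` between definable sets and an integer `N > 0` such that every fibre of `f` has exactly
`N` elements. -/
def EulerCharacteristic.IsStrong {Ω : Type u} {𝒜 : DefinableStructure Ω} {R : Type v} [CommRing R]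
    (χ : EulerCharacteristic 𝒜 R) : Prop :=
  ∀ (n m : ℕ) (A : 𝒜.definable n) (B : 𝒜.definable m)
    (f : ↥A.1 → ↥B.1), 𝒜.IsDefinableMap f →
    ∀ N : ℕ, 0 < N → (∀ b, (f ⁻¹' {b}).encard = N) → χ.val n A = N * χ.val m B

section Constructible

variable (k : Type u) [Field k]

/-- The algebra of constructible subsets of `kⁿ`: the algebra of sets generated by the Zariski
closed subsets, i.e. the zero loci of ideals of `k[X₁, …, Xₙ]`. -/
def constructibleSets (n : ℕ) : BooleanSubalgebra (Set (Fin n → k)) :=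
  BooleanSubalgebra.closure
    (Set.range fun I : Ideal (MvPolynomial (Fin n) k) => MvPolynomial.zeroLocus k I)

variable {k}

theorem constructibleSets_preimage {n m : ℕ} (σ : Fin n → Fin m) {A : Set (Fin n → k)}
    (hA : A ∈ constructibleSets k n) :
    {x : Fin m → k | (fun i => x (σ i)) ∈ A} ∈ constructibleSets k m := by
  induction hA using BooleanSubalgebra.closure_bot_sup_induction with
  | mem A hA =>
    obtain ⟨I, rfl⟩ := hA
    refine BooleanSubalgebra.subset_closure
      ⟨Ideal.span (MvPolynomial.rename σ '' (I : Set (MvPolynomial (Fin n) k))), ?_⟩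
    simp only [MvPolynomial.zeroLocus_span]
    ext x
    simp [MvPolynomial.eval_rename, Function.comp_def]
  | bot => exact BooleanSubalgebra.bot_mem
  | sup A _ B _ h1 h2 => exact BooleanSubalgebra.sup_mem h1 h2
  | compl A _ h => exact BooleanSubalgebra.compl_mem h

theorem mem_pointToPoint_zeroLocus {n : ℕ} (I : Ideal (MvPolynomial (Fin n) k)) (x : Fin n → k) :
    (MvPolynomial.pointToPoint x : PrimeSpectrum (MvPolynomial (Fin n) k)) ∈
      PrimeSpectrum.zeroLocus (I : Set (MvPolynomial (Fin n) k)) ↔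
    x ∈ MvPolynomial.zeroLocus k I := by
  rw [PrimeSpectrum.mem_zeroLocus]
  simp [MvPolynomial.pointToPoint, Set.subset_def]

theorem mem_constructibleSets_iff {n : ℕ} {A : Set (Fin n → k)} :
    A ∈ constructibleSets k n ↔ ∃ C : Set (PrimeSpectrum (MvPolynomial (Fin n) k)),
      Topology.IsConstructible C ∧ MvPolynomial.pointToPoint ⁻¹' C = A := by
  constructor
  · intro hA
    induction hA using BooleanSubalgebra.closure_bot_sup_induction with
    | mem A hA =>
      obtain ⟨I, rfl⟩ := hA
      refine ⟨PrimeSpectrum.zeroLocus I, ?_, ?_⟩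
      · rw [← Topology.isConstructible_compl]
        refine IsRetrocompact.isConstructible
          (PrimeSpectrum.isClosed_zeroLocus _).isOpen_compl ?_
        intro U _ _
        exact TopologicalSpace.NoetherianSpace.isCompact _
      · ext x
        simp only [Set.mem_preimage, mem_pointToPoint_zeroLocus]
    | bot => exact ⟨∅, Topology.IsConstructible.empty, rfl⟩
    | sup A _ B _ h1 h2 =>
      obtain ⟨C, hC, rfl⟩ := h1
      obtain ⟨D, hD, rfl⟩ := h2
      exact ⟨C ∪ D, hC.union hD, rfl⟩
    | compl A _ h =>
      obtain ⟨C, hC, rfl⟩ := h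
      exact ⟨Cᶜ, hC.compl, rfl⟩
  · rintro ⟨C, hC, rfl⟩
    induction hC using Topology.IsConstructible.empty_union_induction with
    | open_retrocompact U hU _ =>
      obtain ⟨s, hs⟩ := (PrimeSpectrum.isOpen_iff _).1 hU
      rw [← BooleanSubalgebra.compl_mem_iff]
      refine BooleanSubalgebra.subset_closure ⟨Ideal.span s, ?_⟩
      rw [← Set.preimage_compl, hs, ← PrimeSpectrum.zeroLocus_span]
      ext x
      simp only [Set.mem_preimage, mem_pointToPoint_zeroLocus]
    | union s hs t ht h1 h2 => exact BooleanSubalgebra.sup_mem h1 h2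
    | compl s hs h => exact BooleanSubalgebra.compl_mem h

theorem exists_isLocallyClosed_of_isConstructible {X : Type u} [TopologicalSpace X] {C : Set X}
    (hC : Topology.IsConstructible C) (p : X) :
    ∃ L : Set X, IsLocallyClosed L ∧ p ∈ L ∧ (L ⊆ C ∨ L ⊆ Cᶜ) := by
  induction hC using Topology.IsConstructible.empty_union_induction with
  | open_retrocompact U hU _ =>
    by_cases hp : p ∈ U
    · exact ⟨U, hU.isLocallyClosed, hp, Or.inl subset_rfl⟩
    · exact ⟨Uᶜ, hU.isClosed_compl.isLocallyClosed, hp, Or.inr subset_rfl⟩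
  | union s hs t ht h1 h2 =>
    obtain ⟨L, hL, hpL, h⟩ := h1
    obtain ⟨M, hM, hpM, h'⟩ := h2
    refine ⟨L ∩ M, hL.inter hM, ⟨hpL, hpM⟩, ?_⟩
    rcases h with h | h
    · exact Or.inl fun x hx => Or.inl (h hx.1)
    · rcases h' with h' | h'
      · exact Or.inl fun x hx => Or.inr (h' hx.2)
      · exact Or.inr fun x hx => not_or.2 ⟨h hx.1, h' hx.2⟩
  | compl s hs h =>
    obtain ⟨L, hL, hp, h⟩ := h
    exact ⟨L, hL, hp, by rw [compl_compl]; exact h.symm⟩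

theorem constructibleSets_proj [IsAlgClosed k] {n : ℕ} {A : Set (Fin (n + 1) → k)}
    (hA : A ∈ constructibleSets k (n + 1)) :
    (fun (x : Fin (n + 1) → k) (i : Fin n) => x i.castSucc) '' A ∈ constructibleSets k n := by
  obtain ⟨C, hC, rfl⟩ := mem_constructibleSets_iff.1 hA
  let φ : MvPolynomial (Fin n) k →ₐ[k] MvPolynomial (Fin (n + 1)) k :=
    MvPolynomial.rename Fin.castSucc
  have hφ : φ.toRingHom.FinitePresentation := by
    rw [← RingHom.FinitePresentation.of_finiteType]
    have : φ.FiniteType := by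
      refine AlgHom.FiniteType.of_comp_finiteType (f := Algebra.ofId k _) ?_
      have : (φ.comp (Algebra.ofId k _)) = Algebra.ofId k _ := Subsingleton.elim _ _
      rw [this]
      have h : Algebra.FiniteType k (MvPolynomial (Fin (n + 1)) k) := inferInstance
      exact RingHom.finiteType_algebraMap.2 h
    exact this
  have hpt : ∀ z : Fin (n + 1) → k,
      PrimeSpectrum.comap φ.toRingHom (MvPolynomial.pointToPoint z) =
      MvPolynomial.pointToPoint (k := k) (fun i : Fin n => z i.castSucc) := by
    intro z
    ext p
    simp [φ, MvPolynomial.pointToPoint, MvPolynomial.aeval_rename, Function.comp_def]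
  have hinj : Function.Injective
      (MvPolynomial.pointToPoint : (Fin n → k) → PrimeSpectrum (MvPolynomial (Fin n) k)) := by
    intro x y hxy
    funext i
    have h : (MvPolynomial.X i - MvPolynomial.C (x i) : MvPolynomial (Fin n) k) ∈
        (MvPolynomial.pointToPoint (k := k) y).asIdeal := by
      rw [← hxy]
      simp [MvPolynomial.pointToPoint]
    have h' : y i - x i = 0 := by simpa [MvPolynomial.pointToPoint] using h
    exact (sub_eq_zero.1 h').symm
  have hmax : ∀ {m : ℕ} (q : PrimeSpectrum (MvPolynomial (Fin m) k)), IsClosed {q} ↔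
      ∃ x : Fin m → k, q = MvPolynomial.pointToPoint x := by
    intro m q
    rw [PrimeSpectrum.isClosed_singleton_iff_isMaximal,
      MvPolynomial.isMaximal_iff_eq_vanishingIdeal_singleton]
    exact exists_congr fun x => by
      rw [PrimeSpectrum.ext_iff]
      simp only [MvPolynomial.pointToPoint]
  refine mem_constructibleSets_iff.2 ⟨_, PrimeSpectrum.isConstructible_comap_image hφ hC, ?_⟩
  ext x
  constructor
  · rintro ⟨p, hpC, hp⟩
    obtain ⟨L, hL, hpL, h⟩ := exists_isLocallyClosed_of_isConstructible hC p
    have hLC : L ⊆ C := h.resolve_right fun h => h hpL hpC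
    have hcl : IsClosed (PrimeSpectrum.comap φ.toRingHom ⁻¹' {MvPolynomial.pointToPoint x}) :=
      ((hmax _).2 ⟨x, rfl⟩).preimage (PrimeSpectrum.continuous_comap _)
    obtain ⟨q, ⟨hqL, hq⟩, hqc⟩ := nonempty_inter_closedPoints
      (Z := L ∩ PrimeSpectrum.comap φ.toRingHom ⁻¹' {MvPolynomial.pointToPoint x})
      ⟨p, hpL, hp⟩ (hL.inter hcl.isLocallyClosed)
    obtain ⟨z, rfl⟩ := (hmax q).1 hqc
    exact ⟨z, hLC hqL, hinj ((hpt z).symm.trans hq)⟩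
  · rintro ⟨z, hz, rfl⟩
    exact ⟨_, hz, hpt z⟩

variable (k)

/-- The structure of constructible sets on an algebraically closed field `k`. -/
def constructibleStructure [IsAlgClosed k] : DefinableStructure k where
  definable := constructibleSets k
  prod_univ_mem hA := constructibleSets_preimage Fin.castSucc hA
  univ_prod_mem hA := constructibleSets_preimage Fin.succ hA
  diagonal_mem n := by
    refine BooleanSubalgebra.subset_closure
      ⟨Ideal.span {MvPolynomial.X 0 - MvPolynomial.X (Fin.last n)}, ?_⟩
    simp only [MvPolynomial.zeroLocus_span]
    ext x
    simp [sub_eq_zero]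
  proj_mem hA := constructibleSets_proj hA

end Constructible

/-!
The value of a strong Euler characteristic on a constructible set `A ⊆ kⁿ` is computed by induction
on `n`, fibring `A ⊆ kⁿ⁺¹` over `kⁿ` by its first `n` coordinates; no dimension theory is needed.

* The fibres `A_x ⊆ k` are uniformly finite or cofinite: there is `M` such that for every `x` either
  `A_x` or its complement has at most `M` points (`exists_encard_fibre_le_or_compl`). Indeed a
  nonzero polynomial in one variable has at most as many zeros as its degree, and the property
  passes to boolean combinations.
* The sets `{x | N ≤ |A_x|}` are constructible (`setOf_le_encard_fibre_mem`).
* If all fibres have at most `M` points, cut off the part where they have exactly `M`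
  points. Strongness computes its value as `M` times the value of its base in `kⁿ`, and on the
  rest the bound has decreased (`hasUniversalValue_of_encard_fibre_le`).
* Where the fibres are cofinite, `A` is the complement in `D × k` of a set with finite fibres, and
  `χ(D × k) = χ(D) χ(k) = χ(D)`. Here `χ(k) = 1`: squaring is a two-to-one map of `k \ {0}` to
  itself, whence `χ(k \ {0}) = 2 χ(k \ {0})` is zero (`EulerCharacteristic.IsStrong.val_line`).

Each of these steps gives an integer independent of `χ` and of the ring of values. When `ℤ → R` is
injective, the axioms satisfied by `χ` descend to the integers.
-/

/-! ### Fibres over the first `n` coordinates -/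

section Fibres

variable {k : Type u}

/-- The fibre of `A ⊆ kⁿ⁺¹` over a point of `kⁿ` with respect to the last coordinate. -/
def fibre {n : ℕ} (A : Set (Fin (n + 1) → k)) (x : Fin n → k) : Set k :=
  {t | (Fin.snoc x t : Fin (n + 1) → k) ∈ A}

theorem fibre_compl {n : ℕ} (A : Set (Fin (n + 1) → k)) (x : Fin n → k) :
    fibre Aᶜ x = (fibre A x)ᶜ := rfl

/-- The part of `A ⊆ kⁿ⁺¹` lying over `D ⊆ kⁿ`. -/
def partOver {n : ℕ} (A : Set (Fin (n + 1) → k)) (D : Set (Fin n → k)) : Set (Fin (n + 1) → k) :=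
  A ∩ {z | (fun i : Fin n => z i.castSucc) ∈ D}

theorem snoc_mem_partOver {n : ℕ} {A : Set (Fin (n + 1) → k)} {D : Set (Fin n → k)} {x : Fin n → k}
    {t : k} : (Fin.snoc x t : Fin (n + 1) → k) ∈ partOver A D ↔ t ∈ fibre A x ∧ x ∈ D := by
  simp [partOver, fibre]

theorem snoc_castSucc_last {n : ℕ} (z : Fin (n + 1) → k) :
    (Fin.snoc (fun i : Fin n => z i.castSucc) (z (Fin.last n)) : Fin (n + 1) → k) = z :=
  Fin.snoc_init_self z

theorem diff_partOver {n : ℕ} (A : Set (Fin (n + 1) → k)) (D : Set (Fin n → k)) :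
    A \ partOver A D = partOver A Dᶜ := by
  ext z
  simp [partOver]

theorem fibre_partOver_subset {n : ℕ} (A : Set (Fin (n + 1) → k)) (D : Set (Fin n → k))
    (x : Fin n → k) : fibre (partOver A D) x ⊆ fibre A x := fun _ ht => ht.1

theorem fibre_partOver_of_notMem {n : ℕ} (A : Set (Fin (n + 1) → k)) {D : Set (Fin n → k)}
    {x : Fin n → k} (hx : x ∉ D) : fibre (partOver A D) x = ∅ :=
  Set.eq_empty_of_forall_notMem fun _ ht => hx (snoc_mem_partOver.1 ht).2

theorem natCast_le_encard_iff {α : Type*} {s : Set α} {N : ℕ} :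
    (N : ℕ∞) ≤ s.encard ↔ ∃ y : Fin N → α, Function.Injective y ∧ ∀ i, y i ∈ s := by
  constructor
  · intro h
    obtain ⟨t, hts, ht⟩ := Set.exists_subset_encard_eq h
    have hfin : t.Finite := Set.finite_of_encard_eq_coe ht
    have hcard : Nat.card t = N := by
      rw [Nat.card_coe_set_eq, Set.ncard, ht, ENat.toNat_natCast]
    have := hfin.to_subtype
    let e := (Finite.equivFinOfCardEq hcard).symm
    exact ⟨fun i => e i, Subtype.val_injective.comp e.injective, fun i => hts (e i).2⟩
  · rintro ⟨y, hy, hys⟩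
    calc (N : ℕ∞) = (Set.range y).encard := by
          rw [← Set.image_univ, hy.encard_image]
          simp
      _ ≤ s.encard := Set.encard_le_encard (Set.range_subset_iff.2 hys)

/-- All fibres of `A ⊆ kⁿ⁺¹` over `kⁿ` have at most `M` points or miss at most `M` points. The
alternative may depend on the fibre, so that the condition passes to boolean combinations. -/
def FibresBoundedBy {n : ℕ} (A : Set (Fin (n + 1) → k)) (M : ℕ) : Prop :=
  ∀ x, (fibre A x).encard ≤ M ∨ (fibre A x)ᶜ.encard ≤ M

theorem FibresBoundedBy.compl {n : ℕ} {A : Set (Fin (n + 1) → k)} {M : ℕ}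
    (h : FibresBoundedBy A M) : FibresBoundedBy Aᶜ M := fun x => by
  rw [fibre_compl, compl_compl]
  exact (h x).symm

theorem FibresBoundedBy.union {n : ℕ} {A B : Set (Fin (n + 1) → k)} {M N : ℕ}
    (hA : FibresBoundedBy A M) (hB : FibresBoundedBy B N) : FibresBoundedBy (A ∪ B) (M + N) := by
  intro x
  have e : fibre (A ∪ B) x = fibre A x ∪ fibre B x := rfl
  rw [e]
  push_cast
  rcases hA x with h | h
  · rcases hB x with h' | h'
    · exact Or.inl ((Set.encard_union_le _ _).trans (add_le_add h h'))
    · refine Or.inr ((Set.encard_le_encard ?_).trans (h'.trans le_add_self))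
      exact Set.compl_subset_compl.2 Set.subset_union_right
  · refine Or.inr ((Set.encard_le_encard ?_).trans (h.trans le_self_add))
    exact Set.compl_subset_compl.2 Set.subset_union_left

theorem FibresBoundedBy.inter {n : ℕ} {A B : Set (Fin (n + 1) → k)} {M N : ℕ}
    (hA : FibresBoundedBy A M) (hB : FibresBoundedBy B N) : FibresBoundedBy (A ∩ B) (M + N) := by
  simpa [Set.compl_union] using (hA.compl.union hB.compl).compl

end Fibres

/-! ### Constructible sets -/

section ConstructibleSets

open MvPolynomial

variable {k : Type u} [Field k]

theorem setOf_eval_eq_zero_mem {n : ℕ} (p : MvPolynomial (Fin n) k) :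
    {x : Fin n → k | eval x p = 0} ∈ constructibleSets k n := by
  refine BooleanSubalgebra.subset_closure ⟨Ideal.span {p}, ?_⟩
  simp only [zeroLocus_span]
  ext x
  simp

theorem setOf_apply_eq_mem {n : ℕ} (i j : Fin n) :
    {x : Fin n → k | x i = x j} ∈ constructibleSets k n := by
  convert setOf_eval_eq_zero_mem (X i - X j : MvPolynomial (Fin n) k) using 1
  ext x
  simp [sub_eq_zero]

theorem setOf_forall_mem {ι : Type*} [Finite ι] {n : ℕ} {S : ι → Set (Fin n → k)}
    (hS : ∀ i, S i ∈ constructibleSets k n) : {x | ∀ i, x ∈ S i} ∈ constructibleSets k n := by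
  convert BooleanSubalgebra.iInf_mem hS using 1
  ext x
  simp

theorem partOver_mem {n : ℕ} {A : Set (Fin (n + 1) → k)} {D : Set (Fin n → k)}
    (hA : A ∈ constructibleSets k (n + 1)) (hD : D ∈ constructibleSets k n) :
    partOver A D ∈ constructibleSets k (n + 1) :=
  BooleanSubalgebra.inf_mem hA (constructibleSets_preimage Fin.castSucc hD)

/-- Constructible sets are stable under forgetting the last `N` coordinates. -/
theorem setOf_exists_append_mem [IsAlgClosed k] {n : ℕ} : ∀ (N : ℕ) {A : Set (Fin (n + N) → k)},
    A ∈ constructibleSets k (n + N) →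
    {x : Fin n → k | ∃ y : Fin N → k, Fin.append x y ∈ A} ∈ constructibleSets k n
  | 0, A, hA => by
    have h : {x : Fin n → k | ∃ y : Fin 0 → k, Fin.append x y ∈ A} = A := by
      refine Set.ext fun x => ?_
      have h : ∀ y : Fin 0 → k, Fin.append x y = x := fun y => by
        rw [Subsingleton.elim y Fin.elim0, Fin.append_elim0]
        rfl
      simp only [h, Set.mem_ofPred_eq, exists_const]
    rw [h]
    exact hA
  | N + 1, A, hA => by
    have h : {x : Fin n → k | ∃ y : Fin (N + 1) → k, Fin.append x y ∈ A} =
        {x | ∃ y : Fin N → k, Fin.append x y ∈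
          (fun (z : Fin (n + N + 1) → k) (i : Fin (n + N)) => z i.castSucc) '' A} := by
      refine Set.ext fun x => ⟨?_, ?_⟩
      · rintro ⟨y, hy⟩
        refine ⟨Fin.init y, (Fin.append x y : Fin (n + (N + 1)) → k), hy, ?_⟩
        rw [← Fin.snoc_init_self y, Fin.append_snoc]
        funext i
        simp
      · rintro ⟨y, z, hz, hzy⟩
        refine ⟨Fin.snoc y (z (Fin.last (n + N))), ?_⟩
        rw [Fin.append_snoc, ← hzy]
        exact (Set.mem_of_eq_of_mem (snoc_castSucc_last (n := n + N) z) hz :)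
    rw [h]
    exact setOf_exists_append_mem N (constructibleSets_proj (n := n + N) hA)

theorem setOf_le_encard_fibre_mem [IsAlgClosed k] {n : ℕ} {A : Set (Fin (n + 1) → k)}
    (hA : A ∈ constructibleSets k (n + 1)) (N : ℕ) :
    {x | (N : ℕ∞) ≤ (fibre A x).encard} ∈ constructibleSets k n := by
  -- The sequences of `N` distinct points in one fibre form a constructible set.
  have h : {z : Fin (n + N) → k |
      (∀ p : {p : Fin N × Fin N // p.1 ≠ p.2},
        z ∈ {z : Fin (n + N) → k | z (Fin.natAdd n p.1.1) = z (Fin.natAdd n p.1.2)}ᶜ) ∧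
      ∀ i : Fin N, z ∈ {z : Fin (n + N) → k | (fun j : Fin (n + 1) =>
        z ((Fin.snoc (Fin.castAdd N) (Fin.natAdd n i) : Fin (n + 1) → Fin (n + N)) j)) ∈ A}} ∈
      constructibleSets k (n + N) :=
    BooleanSubalgebra.inf_mem
      (setOf_forall_mem fun p => BooleanSubalgebra.compl_mem (setOf_apply_eq_mem _ _))
      (setOf_forall_mem fun i => constructibleSets_preimage _ hA)
  convert setOf_exists_append_mem N h using 1
  ext x
  rw [Set.mem_ofPred_eq, natCast_le_encard_iff]
  refine exists_congr fun y => and_congr ?_ (forall_congr' fun i => ?_)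
  · simp only [Set.mem_compl_iff, Set.mem_ofPred_eq, Fin.append_right, Subtype.forall, Prod.forall]
    exact ⟨fun h a b hab e => hab (h e), fun h a b e => by_contra fun hab => h a b hab e⟩
  · have : (fun j : Fin (n + 1) => Fin.append x y
        ((Fin.snoc (Fin.castAdd N) (Fin.natAdd n i) : Fin (n + 1) → Fin (n + N)) j)) =
        (Fin.snoc x (y i) : Fin (n + 1) → k) := by
      ext j
      refine Fin.lastCases ?_ (fun j => ?_) j <;> simp
    simp only [Set.mem_ofPred_eq, this, fibre]

/-! ### Uniform finiteness of fibres -/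

theorem fibresBoundedBy_hypersurface {n : ℕ} (p : MvPolynomial (Fin (n + 1)) k) :
    FibresBoundedBy {z | eval z p = 0} p.totalDegree := by
  intro x
  -- Substituting `x` for all variables but the last gives a polynomial in one variable, of degree
  -- bounded independently of `x`.
  let q : Polynomial k := aeval (fun i => (Fin.snoc (fun j => Polynomial.C (x j)) Polynomial.X :
    Fin (n + 1) → Polynomial k) i) p
  have hq : ∀ t, q.eval t = eval (Fin.snoc x t : Fin (n + 1) → k) p := by
    intro t
    have : (Polynomial.aeval t).comp (aeval (fun i =>
        (Fin.snoc (fun j => Polynomial.C (x j)) Polynomial.X : Fin (n + 1) → Polynomial k) i)) =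
        aeval (Fin.snoc x t : Fin (n + 1) → k) := by
      ext i
      refine Fin.lastCases ?_ (fun i => ?_) i <;> simp
    have h := DFunLike.congr_fun this p
    simpa [q, Polynomial.aeval_def, Polynomial.eval₂_eq_eval_map, MvPolynomial.aeval_eq_eval]
      using h
  have hdeg : q.natDegree ≤ p.totalDegree := by
    have := MvPolynomial.aeval_natDegree_le (n := 1) p le_rfl
      (fun i => (Fin.snoc (fun j => Polynomial.C (x j)) Polynomial.X :
        Fin (n + 1) → Polynomial k) i) (fun i => by
        refine Fin.lastCases ?_ (fun i => ?_) i <;> simp)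
    simpa [q] using this
  have hf : fibre {z | eval z p = 0} x = {t | q.eval t = 0} := by
    ext t
    simp [fibre, hq]
  rw [hf]
  by_cases h0 : q = 0
  · right
    simp [h0]
  · left
    classical
    have : {t | q.eval t = 0} = (q.roots.toFinset : Set k) := by
      ext t
      simp [h0]
    rw [this, Set.encard_coe_eq_coe_finsetCard]
    exact_mod_cast (Multiset.toFinset_card_le _).trans ((Polynomial.card_roots' q).trans hdeg)

theorem exists_fibresBoundedBy_zeroSet {n : ℕ} (s : Finset (MvPolynomial (Fin (n + 1)) k)) :
    ∃ M, FibresBoundedBy {z : Fin (n + 1) → k | ∀ p ∈ s, eval z p = 0} M := by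
  classical
  induction s using Finset.induction_on with
  | empty => exact ⟨0, fun x => Or.inr (by simp [fibre])⟩
  | insert p s _ ih =>
    obtain ⟨M, hM⟩ := ih
    refine ⟨p.totalDegree + M, ?_⟩
    convert (fibresBoundedBy_hypersurface p).inter hM using 1
    ext z
    simp

theorem exists_encard_fibre_le_or_compl {n : ℕ} {A : Set (Fin (n + 1) → k)}
    (hA : A ∈ constructibleSets k (n + 1)) : ∃ M, FibresBoundedBy A M := by
  induction hA using BooleanSubalgebra.closure_bot_sup_induction with
  | mem A hA =>
    obtain ⟨I, rfl⟩ := hA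
    obtain ⟨s, hs⟩ := IsNoetherian.noetherian I
    obtain ⟨M, hM⟩ := exists_fibresBoundedBy_zeroSet s
    refine ⟨M, ?_⟩
    convert hM using 1
    rw [← hs]
    exact zeroLocus_span _
  | bot => exact ⟨0, fun x => Or.inl (by simp [fibre])⟩
  | sup A _ B _ h1 h2 =>
    obtain ⟨M, hM⟩ := h1
    obtain ⟨N, hN⟩ := h2
    exact ⟨_, hM.union hN⟩
  | compl A _ h =>
    obtain ⟨M, hM⟩ := h
    exact ⟨M, hM.compl⟩

end ConstructibleSets

/-! ### Values of Euler characteristics -/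

section Values

variable {k : Type u} [Field k] [IsAlgClosed k] {R : Type v} [CommRing R]

theorem EulerCharacteristic.val_add_val_diff {n : ℕ} {A B : Set (Fin n → k)}
    (χ : EulerCharacteristic (constructibleStructure k) R)
    (hA : A ∈ constructibleSets k n) (hB : B ∈ constructibleSets k n) (h : B ⊆ A) :
    χ.val n ⟨A, hA⟩ = χ.val n ⟨B, hB⟩ + χ.val n ⟨A \ B, BooleanSubalgebra.sdiff_mem hA hB⟩ := by
  rw [← χ.val_union _ _ Set.disjoint_sdiff_right]
  congr 1
  exact Subtype.ext (Set.union_sdiff_cancel h).symm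

theorem EulerCharacteristic.val_empty {n : ℕ}
    (χ : EulerCharacteristic (constructibleStructure k) R)
    (h : (∅ : Set (Fin n → k)) ∈ constructibleSets k n) : χ.val n ⟨∅, h⟩ = 0 := by
  have := χ.val_add_val_diff h h le_rfl
  simpa using this

theorem EulerCharacteristic.val_origin (χ : EulerCharacteristic (constructibleStructure k) R)
    (h : {x : Fin 1 → k | x 0 = 0} ∈ constructibleSets k 1) :
    χ.val 1 ⟨{x | x 0 = 0}, h⟩ = 1 := by
  rw [← χ.val_point]
  refine χ.val_eq_of_bijective ⟨{x | x 0 = 0}, h⟩ ⊤ (fun _ => ⟨Fin.elim0, trivial⟩) ?_ ⟨?_, ?_⟩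
  · change _ ∈ constructibleSets k (1 + 0)
    convert h using 1
    ext z
    constructor
    · rintro ⟨a, rfl⟩
      exact a.2
    · intro hz
      exact ⟨⟨z, hz⟩, by rw [Fin.append_elim0]; rfl⟩
  · intro a b _
    ext i
    rw [Subsingleton.elim i 0, show a.1 0 = 0 from a.2, show b.1 0 = 0 from b.2]
  · intro b
    exact ⟨⟨fun _ => 0, rfl⟩, Subtype.ext (Subsingleton.elim _ _)⟩

/-- Squaring maps `k \ {0}` two-to-one onto itself, which forces `χ(k \ {0}) = 0`. -/
theorem EulerCharacteristic.IsStrong.val_units [CharZero k]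
    {χ : EulerCharacteristic (constructibleStructure k) R} (hχ : χ.IsStrong)
    (h : {x : Fin 1 → k | x 0 = 0}ᶜ ∈ constructibleSets k 1) :
    χ.val 1 ⟨{x | x 0 = 0}ᶜ, h⟩ = 0 := by
  let f : ↥({x : Fin 1 → k | x 0 = 0}ᶜ) → ↥({x : Fin 1 → k | x 0 = 0}ᶜ) :=
    fun a => ⟨fun _ => a.1 0 ^ 2, pow_ne_zero 2 a.2⟩
  have hval : ∀ a, (f a).1 0 = a.1 0 ^ 2 := fun _ => rfl
  have hext : ∀ a b : ↥({x : Fin 1 → k | x 0 = 0}ᶜ), a = b ↔ a.1 0 = b.1 0 := fun a b =>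
    ⟨fun h => by rw [h], fun h => Subtype.ext (funext fun i => by
      rw [Subsingleton.elim i 0, h])⟩
  have key := hχ 1 1 ⟨_, h⟩ ⟨_, h⟩ f ?_ 2 two_pos ?_
  · push_cast at key
    linear_combination -key
  · have hg : {z : Fin (1 + 1) → k | (fun i : Fin 1 => z (Fin.castAdd 1 i)) ∈
        {x : Fin 1 → k | x 0 = 0}ᶜ} ∩ {z | MvPolynomial.eval z
        (MvPolynomial.X 1 - MvPolynomial.X 0 ^ 2 : MvPolynomial (Fin (1 + 1)) k) = 0} ∈
        constructibleSets k (1 + 1) :=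
      BooleanSubalgebra.inf_mem (constructibleSets_preimage _ h) (setOf_eval_eq_zero_mem _)
    change _ ∈ constructibleSets k (1 + 1)
    convert hg using 1
    ext z
    constructor
    · rintro ⟨a, rfl⟩
      refine ⟨?_, ?_⟩
      · simp only [Set.mem_ofPred_eq, Fin.append_left]
        exact a.2
      · have e0 : Fin.append a.1 (f a).1 0 = a.1 0 := Fin.append_left a.1 (f a).1 0
        have e1 : Fin.append a.1 (f a).1 1 = (f a).1 0 := Fin.append_right a.1 (f a).1 0
        simp [e0, e1, hval]
    · rintro ⟨h1, h2⟩
      refine ⟨⟨fun i => z (Fin.castAdd 1 i), h1⟩, ?_⟩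
      have h3 : z 1 = z 0 ^ 2 := by simpa [sub_eq_zero] using h2
      funext i
      refine Fin.addCases (fun i => ?_) (fun i => ?_) i
      · rw [Fin.append_left]
      · rw [Fin.append_right, Subsingleton.elim i 0]
        exact h3
  · intro b
    obtain ⟨r, hr⟩ := IsAlgClosed.exists_pow_nat_eq (b.1 0) two_pos
    have hr0 : r ≠ 0 := fun h0 => b.2 (by
      change b.1 0 = 0
      rw [← hr, h0, zero_pow two_ne_zero])
    change _ = (2 : ℕ∞)
    rw [Set.encard_eq_two]
    refine ⟨⟨fun _ => r, hr0⟩, ⟨fun _ => -r, neg_ne_zero.2 hr0⟩, ?_, ?_⟩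
    · rw [Ne, hext]
      exact fun h => hr0 (self_eq_neg.1 h)
    · ext a
      simp only [Set.mem_preimage, Set.mem_singleton_iff, Set.mem_insert_iff, hext, hval, ← hr]
      exact sq_eq_sq_iff_eq_or_eq_neg

theorem EulerCharacteristic.IsStrong.val_line [CharZero k]
    {χ : EulerCharacteristic (constructibleStructure k) R} (hχ : χ.IsStrong) : χ.val 1 ⊤ = 1 := by
  have h : {x : Fin 1 → k | x 0 = 0} ∈ constructibleSets k 1 := by
    simpa using setOf_eval_eq_zero_mem (MvPolynomial.X 0 : MvPolynomial (Fin 1) k)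
  have key := χ.val_add_val_diff BooleanSubalgebra.top_mem h (Set.subset_univ _)
  rw [χ.val_origin] at key
  refine key.trans (add_eq_left.2 ?_)
  have h0 := hχ.val_units (BooleanSubalgebra.compl_mem h)
  simp only [Set.compl_eq_univ_sdiff] at h0
  exact h0

theorem EulerCharacteristic.IsStrong.val_cylinder [CharZero k]
    {χ : EulerCharacteristic (constructibleStructure k) R} (hχ : χ.IsStrong) {n : ℕ}
    {D : Set (Fin n → k)} (hD : D ∈ constructibleSets k n)
    (h : partOver Set.univ D ∈ constructibleSets k (n + 1)) :
    χ.val (n + 1) ⟨partOver Set.univ D, h⟩ = χ.val n ⟨D, hD⟩ := by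
  have := χ.val_prod ⟨D, hD⟩ (⊤ : (constructibleStructure k).definable 1)
  rw [hχ.val_line, mul_one] at this
  rw [← this]
  congr 1
  refine Subtype.ext (Set.ext fun z => ?_)
  exact ⟨fun hz => ⟨hz.2, trivial⟩, fun hz => ⟨trivial, hz.1⟩⟩

/-- Strongness applied to the projection to the first `n` coordinates. -/
theorem EulerCharacteristic.IsStrong.val_partOver
    {χ : EulerCharacteristic (constructibleStructure k) R} (hχ : χ.IsStrong) {n N : ℕ}
    (hN : 0 < N) {A : Set (Fin (n + 1) → k)} {D : Set (Fin n → k)}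
    (hA : A ∈ constructibleSets k (n + 1)) (hD : D ∈ constructibleSets k n)
    (h : ∀ x ∈ D, (fibre A x).encard = N) :
    χ.val (n + 1) ⟨partOver A D, partOver_mem hA hD⟩ = N * χ.val n ⟨D, hD⟩ := by
  refine hχ (n + 1) n ⟨partOver A D, partOver_mem hA hD⟩ ⟨D, hD⟩
    (fun a => ⟨fun i => a.1 i.castSucc, a.2.2⟩) ?_ N hN ?_
  · have hg : {z : Fin (n + 1 + n) → k |
        (fun i : Fin (n + 1) => z (Fin.castAdd n i)) ∈ partOver A D} ∩
        {z | ∀ i : Fin n, z ∈ {z : Fin (n + 1 + n) → k |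
          z (Fin.natAdd (n + 1) i) = z (Fin.castAdd n i.castSucc)}} ∈
        constructibleSets k (n + 1 + n) :=
      BooleanSubalgebra.inf_mem (constructibleSets_preimage _ (partOver_mem hA hD))
        (setOf_forall_mem fun i => setOf_apply_eq_mem _ _)
    change _ ∈ constructibleSets k (n + 1 + n)
    convert hg using 1
    ext z
    constructor
    · rintro ⟨a, rfl⟩
      refine ⟨?_, fun i => ?_⟩
      · simp only [Set.mem_ofPred_eq, Fin.append_left]
        exact a.2
      · simp only [Set.mem_ofPred_eq, Fin.append_left, Fin.append_right]
    · rintro ⟨h1, h2⟩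
      refine ⟨⟨_, h1⟩, funext fun i => ?_⟩
      refine Fin.addCases (fun i => ?_) (fun i => ?_) i
      · simp only [Fin.append_left]
      · simp only [Fin.append_right]
        exact h2 i
  · intro b
    rw [← h b.1 b.2]
    refine Set.encard_congr
      { toFun := fun a => ⟨a.1.1 (Fin.last n), ?_⟩
        invFun := fun t => ⟨⟨(Fin.snoc b.1 t.1 : Fin (n + 1) → k),
          snoc_mem_partOver.2 ⟨t.2, b.2⟩⟩, ?_⟩
        left_inv := ?_
        right_inv := ?_ }
    · have hb : (fun i : Fin n => a.1.1 i.castSucc) = b.1 := congrArg Subtype.val a.2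
      change (Fin.snoc b.1 _ : Fin (n + 1) → k) ∈ A
      rw [← hb, snoc_castSucc_last]
      exact a.1.2.1
    · refine Subtype.ext (funext fun i => ?_)
      exact Fin.snoc_castSucc (α := fun _ => k) _ _ i
    · intro a
      have hb : (fun i : Fin n => a.1.1 i.castSucc) = b.1 := congrArg Subtype.val a.2
      refine Subtype.ext (Subtype.ext ?_)
      refine Eq.trans ?_ (snoc_castSucc_last a.1.1)
      exact congrArg (fun w => (Fin.snoc w _ : Fin (n + 1) → k)) hb.symm
    · intro t
      exact Subtype.ext (Fin.snoc_last (α := fun _ => k) _ _)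

end Values

/-! ### Values common to all strong Euler characteristics -/

section UniversalValues

variable {k : Type u} [Field k] [IsAlgClosed k]

/-- All strong Euler characteristics (with values in rings in the universe `v`) take on `A` the
value given by one and the same integer. -/
def HasUniversalValue {n : ℕ} (A : (constructibleStructure k).definable n) : Prop :=
  ∃ e : ℤ, ∀ (R : Type v) [CommRing R] (χ : EulerCharacteristic (constructibleStructure k) R),
    χ.IsStrong → χ.val n A = e

theorem hasUniversalValue_of_diff {n : ℕ} {A B : Set (Fin n → k)}
    (hA : A ∈ constructibleSets k n) (hB : B ∈ constructibleSets k n) (h : B ⊆ A)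
    (hB' : HasUniversalValue.{u, v} ⟨B, hB⟩)
    (hd : HasUniversalValue.{u, v} ⟨A \ B, BooleanSubalgebra.sdiff_mem hA hB⟩) :
    HasUniversalValue.{u, v} ⟨A, hA⟩ := by
  obtain ⟨b, hb⟩ := hB'
  obtain ⟨c, hc⟩ := hd
  refine ⟨b + c, fun R _ χ hχ => ?_⟩
  rw [χ.val_add_val_diff hA hB h, hb R χ hχ, hc R χ hχ, Int.cast_add]

/-- The inductive step from `kⁿ` to `kⁿ⁺¹` for sets finite over `kⁿ`: strongness reduces them to
their images in `kⁿ`, one fibre cardinality at a time. -/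
theorem hasUniversalValue_of_encard_fibre_le {n : ℕ}
    (ih : ∀ D : (constructibleStructure k).definable n, HasUniversalValue.{u, v} D) (M : ℕ)
    {A : Set (Fin (n + 1) → k)} (hA : A ∈ constructibleSets k (n + 1))
    (h : ∀ x, (fibre A x).encard ≤ M) : HasUniversalValue.{u, v} ⟨A, hA⟩ := by
  induction M generalizing A with
  | zero =>
    have : A = ∅ := by
      refine Set.eq_empty_of_forall_notMem fun z hz => ?_
      have h0 : fibre A (fun i => z i.castSucc) = ∅ := by simpa using h (fun i => z i.castSucc)
      have hz' : z (Fin.last n) ∈ fibre A (fun i => z i.castSucc) := by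
        change Fin.snoc _ _ ∈ A
        rwa [snoc_castSucc_last]
      simp [h0] at hz'
    subst this
    exact ⟨0, fun R _ χ _ => by simpa using χ.val_empty hA⟩
  | succ M ihM =>
    -- `D` is the locus where the bound `M + 1` on the fibre cardinality is attained.
    have hD := setOf_le_encard_fibre_mem hA (M + 1)
    set D := {x | ((M + 1 : ℕ) : ℕ∞) ≤ (fibre A x).encard} with hDdef
    refine hasUniversalValue_of_diff hA (partOver_mem hA hD) Set.inter_subset_left ?_ ?_
    · obtain ⟨d, hd⟩ := ih ⟨D, hD⟩
      refine ⟨(M + 1 : ℕ) * d, fun R _ χ hχ => ?_⟩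
      rw [hχ.val_partOver M.succ_pos hA hD fun x hx => le_antisymm (h x) hx, hd R χ hχ]
      push_cast
      rfl
    · refine ihM _ fun x => ?_
      rw [diff_partOver]
      by_cases hx : x ∈ D
      · rw [fibre_partOver_of_notMem _ (not_not.2 hx)]
        simp
      · refine (Set.encard_le_encard (fibre_partOver_subset _ _ _)).trans ?_
        refine Order.le_of_lt_add_one ?_
        simpa [hDdef] using hx

theorem hasUniversalValue [CharZero k] :
    ∀ (n : ℕ) (A : (constructibleStructure k).definable n), HasUniversalValue.{u, v} A
  | 0, A => by
    rcases Set.eq_empty_or_nonempty A.1 with h | ⟨x, hx⟩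
    · obtain ⟨A, hA⟩ := A
      obtain rfl : A = ∅ := h
      exact ⟨0, fun R _ χ _ => by simpa using χ.val_empty hA⟩
    · have : A = ⊤ := Subtype.ext (Set.eq_univ_of_forall fun y => Subsingleton.elim x y ▸ hx)
      subst this
      exact ⟨1, fun R _ χ _ => by simpa using χ.val_point⟩
  | n + 1, ⟨A, hA⟩ => by
    have ih := hasUniversalValue n
    replace hA : A ∈ constructibleSets k (n + 1) := hA
    obtain ⟨M, hM⟩ := exists_encard_fibre_le_or_compl hA
    -- Over `E` the fibres of `A` have more than `M` points, hence miss at most `M` points.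
    have hE := setOf_le_encard_fibre_mem hA (M + 1)
    set E := {x | ((M + 1 : ℕ) : ℕ∞) ≤ (fibre A x).encard} with hEdef
    have hlt : ∀ x, x ∉ E ↔ (fibre A x).encard ≤ M := fun x => by
      simp only [hEdef, Set.mem_ofPred_eq, not_le, Nat.cast_add, Nat.cast_one]
      exact ENat.lt_add_one_iff (ENat.natCast_ne_top M)
    have hAc : Aᶜ ∈ constructibleSets k (n + 1) := BooleanSubalgebra.compl_mem hA
    refine hasUniversalValue_of_diff hA (partOver_mem hA hE) Set.inter_subset_left ?_ ?_
    -- Over `E`, `A` is the complement in `E × k` of a set with at most `M` points in each fibre.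
    · obtain ⟨a, ha⟩ := ih ⟨E, hE⟩
      obtain ⟨b, hb⟩ := hasUniversalValue_of_encard_fibre_le ih M (partOver_mem hAc hE) fun x => by
        by_cases hx : x ∈ E
        · refine (Set.encard_le_encard (fibre_partOver_subset _ _ _)).trans ?_
          exact (hM x).resolve_left fun h => (hlt x).2 h hx
        · rw [fibre_partOver_of_notMem _ hx]
          simp
      refine ⟨a - b, fun R _ χ hχ => ?_⟩
      have hC : partOver Set.univ E ∈ constructibleSets k (n + 1) :=
        partOver_mem BooleanSubalgebra.top_mem hE
      have key := χ.val_add_val_diff hC (partOver_mem hAc hE)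
        (Set.inter_subset_inter_left _ (Set.subset_univ _))
      have hdiff : partOver Set.univ E \ partOver Aᶜ E = partOver A E := by
        ext z
        simp only [partOver, Set.mem_sdiff, Set.mem_inter_iff, Set.mem_univ, true_and,
          Set.mem_compl_iff]
        tauto
      rw [hχ.val_cylinder hE hC, ha R χ hχ, hb R χ hχ] at key
      simp only [hdiff] at key
      rw [Int.cast_sub, key, add_sub_cancel_left]
    · refine hasUniversalValue_of_encard_fibre_le ih M _ fun x => ?_
      rw [diff_partOver]
      by_cases hx : x ∈ E
      · rw [fibre_partOver_of_notMem _ (not_not.2 hx)]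
        simp
      · exact (Set.encard_le_encard (fibre_partOver_subset _ _ _)).trans ((hlt x).1 hx)

end UniversalValues

/-- When `ℤ → R` is injective, an Euler characteristic with integral values descends to `ℤ`. -/
def EulerCharacteristic.descend {Ω : Type u} {𝒜 : DefinableStructure Ω} {R : Type v} [CommRing R]
    [CharZero R] (χ : EulerCharacteristic 𝒜 R) (e : ∀ n : ℕ, 𝒜.definable n → ℤ)
    (he : ∀ n A, χ.val n A = e n A) : EulerCharacteristic 𝒜 ℤ where
  val := e
  val_union A B h := Int.cast_injective (α := R) <| by
    rw [Int.cast_add, ← he, ← he, ← he, χ.val_union A B h]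
  val_prod A B := Int.cast_injective (α := R) <| by
    rw [Int.cast_mul, ← he, ← he, ← he, χ.val_prod A B]
  val_eq_of_bijective A B f hf hbij := Int.cast_injective (α := R) <| by
    rw [← he, ← he, χ.val_eq_of_bijective A B f hf hbij]
  val_point := Int.cast_injective (α := R) <| by
    rw [← he, χ.val_point, Int.cast_one]

theorem mainTheorem4 (k : Type u) [Field k] [IsAlgClosed k] [CharZero k] :
    (∀ (R : Type v) [CommRing R] (χ₁ χ₂ : EulerCharacteristic (constructibleStructure k) R),
      χ₁.IsStrong → χ₂.IsStrong → χ₁ = χ₂) ∧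
    (∃ e : ∀ n : ℕ, (constructibleStructure k).definable n → ℤ,
      ∀ (R : Type v) [CommRing R] (χ : EulerCharacteristic (constructibleStructure k) R),
        χ.IsStrong → ∀ (n : ℕ) (A : (constructibleStructure k).definable n),
          χ.val n A = (e n A : R)) ∧
    (∀ (R : Type v) [CommRing R] [CharZero R]
      (χ : EulerCharacteristic (constructibleStructure k) R), χ.IsStrong →
        ∃ χ' : EulerCharacteristic (constructibleStructure k) ℤ, χ'.IsStrong ∧
          ∀ (n : ℕ) (A : (constructibleStructure k).definable n),
            χ.val n A = (χ'.val n A : R)) := by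
  choose e he using hasUniversalValue.{u, v} (k := k)
  refine ⟨fun R _ χ₁ χ₂ h₁ h₂ => ?_, ⟨e, fun R _ χ hχ n A => he n A R χ hχ⟩,
    fun R _ _ χ hχ => ⟨χ.descend e fun n A => he n A R χ hχ, ?_, fun n A => he n A R χ hχ⟩⟩
  · ext n A
    rw [he n A R χ₁ h₁, he n A R χ₂ h₂]
  · intro n m A B f hf N hN hfib
    apply Int.cast_injective (α := R)
    have := hχ n m A B f hf N hN hfib
    rw [he n A R χ hχ, he m B R χ hχ] at this
    simpa [EulerCharacteristic.descend] using this
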